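/- A variety of groups is a class of groups closed under subgroups, homomorphic images and arbitrary direct products. For a variety $\mathcal V$, a group $A\in\mathcal V$ and a subgroup $B\le A$, the dominion of $B$ in $A$ (in $\mathcal V$) is $$\mathrm{dom}_A^{\mathcal V}(B)=\{a\in A : f(a)=g(a)\text{ for all } C\in\mathcal V \text{ and all homomorphisms } f,g\colon A\to C \text{ with } f|_B=g|_B\},$$ and it is trivial if it equals $B$. Theorem. Let $\mathcal V$ be a variety of groups that contains a nonabelian group, is torsion free (every relatively free group of $\mathcal V$ is torsion free) and is locally nilpotent (every finitely generated group in $\mathcal V$ is nilpotent). Then $\mathcal V$ has instances of nontrivial dominions, that is, there are $A\in\mathcal V$ and $B\le A$ with $\mathrm{dom}_A^{\mathcal V}(B)\ne B$. Namely, let $F=F^{(2)}(x,y)$ be the free nilpotent group of class two on $x,y$, i.e. the relatively free group on $x,y$ in the variety of nilpotent groups of class at most two. Then $F\in\mathcal V$, the relatively free $\mathcal V$-group on four generators is nilpotent, and for every prime $p$ greater than its nilpotency class $$\langle x^p,y^p\rangle\subsetneq \mathrm{dom}_{F}^{\mathcal V}\bigl(\langle x^p,y^p\rangle\bigr)=\langle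 x^p,y^p,[x,y]^p\rangle,$$ where $[x,y]=x^{-1}y^{-1}xy$. -/

import Mathlib

universe u

/-- A variety of groups: a class of groups (in a fixed universe) closed under subgroups, quotients
(homomorphic images, hence also isomorphic copies), and arbitrary direct products. -/
structure GroupVariety where
  Mem : ∀ (G : Type u) [Group G], Prop
  subgroup_mem : ∀ (G : Type u) [Group G] (H : Subgroup G), Mem G → Mem H
  image_mem : ∀ (G K : Type u) [Group G] [Group K] (f : G →* K),
    Function.Surjective f → Mem G → Mem K
  pi_mem : ∀ (ι : Type u) (G : ι → Type u) [∀ i, Group (G i)], (∀ i, Mem (G i)) → Mem (∀ i, G i)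

namespace GroupVariety

/-- The variety contains a nonabelian group. -/
def IsNonabelian (V : GroupVariety.{u}) : Prop :=
  ∃ (G : Type u) (_ : Group G), V.Mem G ∧ ∃ a b : G, a * b ≠ b * a

/-- Every finitely generated group of the variety is nilpotent. -/
def IsLocallyNilpotent (V : GroupVariety.{u}) : Prop :=
  ∀ (G : Type u) [Group G], V.Mem G → Group.FG G → Group.IsNilpotent G

/-- The words on `X` that are laws of `V`: the elements of the free group on `X` that are killed by
every homomorphism to a group of `V`. -/
def laws (V : GroupVariety.{u}) (X : Type u) : Subgroup (FreeGroup X) where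
  carrier := {w | ∀ (C : Type u) [Group C], V.Mem C → ∀ f : FreeGroup X →* C, f w = 1}
  one_mem' := fun _ _ _ f => map_one f
  mul_mem' := fun ha hb C _ hC f => by rw [map_mul, ha C hC f, hb C hC f, one_mul]
  inv_mem' := fun ha C _ hC f => by rw [map_inv, ha C hC f, inv_one]

instance laws_normal (V : GroupVariety.{u}) (X : Type u) : (V.laws X).Normal where
  conj_mem := fun w hw g C _ hC f => by simp [hw C hC f]

/-- The relatively free `V`-group on the set `X`. -/
abbrev RelFree (V : GroupVariety.{u}) (X : Type u) : Type u := FreeGroup X ⧸ V.laws X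

/-- The free generator of the relatively free `V`-group attached to `i : X`. -/
def gen (V : GroupVariety.{u}) {X : Type u} (i : X) : V.RelFree X :=
  QuotientGroup.mk (FreeGroup.of i)

/-- All relatively free groups of the variety are torsion free: only `1` has finite order. -/
def IsTorsionFree (V : GroupVariety.{u}) : Prop :=
  ∀ (X : Type u) (g : V.RelFree X), IsOfFinOrder g → g = 1

/-- The dominion of `H` in `A` in the category `V`: the elements on which any two homomorphisms
from `A` to a group of `V` agree as soon as they agree on `H`. -/
def dominion (V : GroupVariety.{u}) {A : Type u} [Group A] (H : Subgroup A) : Subgroup A where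
  carrier := {a | ∀ (C : Type u) [Group C], V.Mem C → ∀ f g : A →* C,
    (∀ h ∈ H, f h = g h) → f a = g a}
  one_mem' := fun _ _ _ f g _ => by rw [map_one, map_one]
  mul_mem' := fun ha hb C _ hC f g hfg => by
    rw [map_mul, map_mul, ha C hC f g hfg, hb C hC f g hfg]
  inv_mem' := fun ha C _ hC f g hfg => by rw [map_inv, map_inv, ha C hC f g hfg]

/-- Some subgroup of some group of `V` differs from its dominion. -/
def HasNontrivialDominions (V : GroupVariety.{u}) : Prop :=
  ∃ (A : Type u) (_ : Group A) (H : Subgroup A), V.Mem A ∧ V.dominion H ≠ H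

/-- The variety `𝒩_c` of all nilpotent groups of class at most `c`. -/
def nilpotent (c : ℕ) : GroupVariety.{u} where
  Mem := fun G _ => Group.IsNilpotent G ∧ Group.nilpotencyClass G ≤ c
  subgroup_mem := fun G _ H ⟨h, hc⟩ =>
    ⟨inferInstance, (Subgroup.nilpotencyClass_le H).trans hc⟩
  image_mem := fun G K _ _ f hf ⟨h, hc⟩ =>
    ⟨Group.nilpotent_of_surjective f hf, (Group.nilpotencyClass_le_of_surjective f hf).trans hc⟩
  pi_mem := fun ι G _ h => by
    have key : (⊤ : Subgroup (∀ i, G i)).lowerCentralSeries c = ⊥ := by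
      rw [eq_bot_iff]
      intro x hx
      rw [Subgroup.mem_bot]
      funext i
      have := (h i).1
      have h1 : Pi.evalMonoidHom G i x ∈
          ((⊤ : Subgroup (∀ i, G i)).lowerCentralSeries c).map (Pi.evalMonoidHom G i) := ⟨x, hx, rfl⟩
      rw [Subgroup.map_lowerCentralSeries] at h1
      have h2 := Subgroup.lowerCentralSeries_mono c
        (le_top : (⊤ : Subgroup (∀ i, G i)).map (Pi.evalMonoidHom G i) ≤ ⊤) h1
      have h3 := Subgroup.lowerCentralSeries_eq_bot_iff_nilpotencyClass_le.2 (h i).2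
      exact Subgroup.mem_bot.1 (h3.le h2)
    have hn : Group.IsNilpotent (∀ i, G i) := Subgroup.nilpotent_iff_lowerCentralSeries.2 ⟨c, key⟩
    exact ⟨hn, Subgroup.lowerCentralSeries_eq_bot_iff_nilpotencyClass_le.1 key⟩

end GroupVariety

/-- The free nilpotent group of class two on two generators. -/
abbrev FreeClassTwo : Type u := (GroupVariety.nilpotent.{u} 2).RelFree (ULift.{u} (Fin 2))

namespace FreeClassTwo

/-- The first free generator. -/
def x : FreeClassTwo.{u} := GroupVariety.gen _ ⟨0⟩

/-- The second free generator. -/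
def y : FreeClassTwo.{u} := GroupVariety.gen _ ⟨1⟩

/-- The subgroup `⟨x ^ n, y ^ n⟩`. -/
def powers (n : ℕ) : Subgroup FreeClassTwo.{u} := Subgroup.closure {x ^ n, y ^ n}

/-- The subgroup `⟨x ^ n, y ^ n, [x, y] ^ n⟩`, where `[x, y] = x⁻¹ y⁻¹ x y`. -/
def powersComm (n : ℕ) : Subgroup FreeClassTwo.{u} :=
  Subgroup.closure {x ^ n, y ^ n, (x⁻¹ * y⁻¹ * x * y) ^ n}

end FreeClassTwo

/-! The heart is a regularity property: in a group of class less than `p`, the elements with trivial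
`p`-th power form a normal subgroup `N`, and `a ^ p = a' ^ p` forces `a ≡ a'` mod `N`. So `[a, b] ^
p` depends only on `a ^ p` and `b ^ p`. If `f` and `g` agree on `x ^ p` and `y ^ p`, then `f x, g x,
f y, g y` generate an image of the relatively free group of rank four, whose class is less than `p`;
hence `f` and `g` agree on `[x, y] ^ p` (`commutator_pow_mem_dominion`).

Regularity is an induction on the class (`isPowRegular_of_lowerCentralSeries_eq_bot`). Its input is
`(a * b) ^ p = a ^ p * b ^ p` when `a` and `b` commute modulo a normal subgroup of exponent `p`,
obtained from Taylor expansions of polynomial sequences instead of Hall's collection formula.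

The upper bound and strictness are computations with Heisenberg groups over `ZMod p` and `ℤ`.
Membership of the free class two group in `V` holds because a noncentral element of the second
centre of a relatively free group gives a nontrivial central commutator, of infinite order, so a
two-variable law of `V` must be trivial in class two. -/

open scoped commutatorElement

/-! ### Filtrations and polynomial sequences -/

/-- A descending filtration of subgroups with `⁅G_i, G_j⁆ ≤ G_{i+j}`. -/
structure CommutatorFiltration (G : Type*) [Group G] where
  term : ℕ → Subgroup G
  term_succ_le : ∀ i, term (i + 1) ≤ term i
  commutator_le : ∀ i j, ⁅term i, term j⁆ ≤ term (i + j)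

namespace CommutatorFiltration

variable {G : Type*} [Group G]

theorem antitone (F : CommutatorFiltration G) : Antitone F.term :=
  antitone_nat_of_succ_le F.term_succ_le

theorem commutatorElement_mem (F : CommutatorFiltration G) {i j : ℕ} {g h : G}
    (hg : g ∈ F.term i) (hh : h ∈ F.term j) : ⁅g, h⁆ ∈ F.term (i + j) :=
  F.commutator_le i j (Subgroup.commutator_mem_commutator hg hh)

theorem conj_mem (F : CommutatorFiltration G) {i : ℕ} {g n : G}
    (hg : g ∈ F.term 0) (hn : n ∈ F.term i) : g * n * g⁻¹ ∈ F.term i := by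
  have h : ⁅g, n⁆ ∈ F.term i := by simpa using F.commutatorElement_mem hg hn
  simpa [commutatorElement_def] using mul_mem h hn

theorem inv_conj_mem (F : CommutatorFiltration G) {i : ℕ} {g n : G}
    (hg : g ∈ F.term 0) (hn : n ∈ F.term i) : g⁻¹ * n * g ∈ F.term i := by
  simpa using F.conj_mem (inv_mem hg) hn

theorem mem_zero (F : CommutatorFiltration G) {i : ℕ} {g : G} (hg : g ∈ F.term i) :
    g ∈ F.term 0 :=
  F.antitone (Nat.zero_le i) hg

/-- The filtration on `G × G` by the pairs `(g, g * u)` with `g ∈ G_i` and `u ∈ G_{i+1}`. -/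
def pair (F : CommutatorFiltration G) : CommutatorFiltration (G × G) where
  term i :=
    { carrier := {q | q.1 ∈ F.term i ∧ q.1⁻¹ * q.2 ∈ F.term (i + 1)}
      one_mem' := by simp
      mul_mem' := by
        rintro ⟨g, g'⟩ ⟨h, h'⟩ ⟨hg, hg'⟩ ⟨hh, hh'⟩
        refine ⟨mul_mem hg hh, ?_⟩
        have := mul_mem (F.inv_conj_mem (F.mem_zero hh) hg') hh'
        simpa [mul_assoc] using this
      inv_mem' := by
        rintro ⟨g, g'⟩ ⟨hg, hg'⟩
        refine ⟨inv_mem hg, ?_⟩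
        have := F.conj_mem (F.mem_zero hg) (inv_mem hg')
        simpa [mul_assoc] using this }
  term_succ_le i _ hq := ⟨F.term_succ_le _ hq.1, F.term_succ_le _ hq.2⟩
  commutator_le i j := by
    rw [Subgroup.commutator_le]
    rintro ⟨g, g'⟩ ⟨hg, hg'⟩ ⟨h, h'⟩ ⟨hh, hh'⟩
    refine ⟨F.commutatorElement_mem hg hh, ?_⟩
    obtain ⟨u, rfl⟩ : ∃ u, g' = g * u := ⟨g⁻¹ * g', by simp⟩
    obtain ⟨v, rfl⟩ : ∃ v, h' = h * v := ⟨h⁻¹ * h', by simp⟩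
    simp only [inv_mul_cancel_left] at hg' hh'
    have h1 : ⁅u, h * v⁆ ∈ F.term (i + j + 1) := by
      have := F.commutatorElement_mem hg' (mul_mem hh (F.term_succ_le j hh'))
      rwa [show i + 1 + j = i + j + 1 by ring] at this
    have h2 : ⁅g, v⁆ ∈ F.term (i + j + 1) :=
      F.commutatorElement_mem (i := i) (j := j + 1) hg hh'
    have h3 := F.inv_conj_mem (F.mem_zero (F.commutatorElement_mem hg hh))
      (F.conj_mem (F.mem_zero hg) h1)
    have h4 := F.conj_mem (F.mem_zero hh) h2
    -- This uses `[gu, hv] = g[u, hv]g⁻¹ · [g, h] · h[g, v]h⁻¹`.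
    have h5 := mul_mem h3 h4
    simpa [commutatorElement_def, mul_assoc] using h5

/-- The map sending a sequence to the sequence of its pairs of consecutive terms. -/
def consecutive (G : Type*) [Group G] : (ℕ → G) →* (ℕ → G × G) where
  toFun f n := (f n, f (n + 1))
  map_one' := rfl
  map_mul' _ _ := rfl

/-- The sequences that are polynomial up to order `d` for a filtration. -/
def poly : ∀ (_ : ℕ) {G : Type*} [Group G], CommutatorFiltration G → Subgroup (ℕ → G)
  | 0, _, _, F => Subgroup.pi Set.univ fun _ => F.term 0
  -- Pairs replace the difference `(f n)⁻¹ * f (n + 1)`: passing to pairs is a homomorphism, so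
  -- closure under products and inverses is automatic.
  | d + 1, _, _, F => (poly d F.pair).comap (consecutive _)

/-- Pascal's rule writes a consecutive pair as `(g, g) ^ n.choose (i + 1) * (1, g) ^ n.choose i`,
and `(1, g)` lies one step lower in the pair filtration. -/
theorem choose_pow_mem_poly (d : ℕ) : ∀ {G : Type*} [Group G] (F : CommutatorFiltration G)
    (i : ℕ) (g : G), g ∈ F.term i → (fun n => g ^ n.choose i) ∈ F.poly d := by
  induction d with
  | zero =>
    intro G _ F i g hg
    simp only [poly, Subgroup.mem_pi]
    exact fun n _ => pow_mem (F.mem_zero hg) _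
  | succ d ih =>
    intro G _ F i g hg
    have h1 := ih F.pair i (g, g) ⟨hg, by simp⟩
    change consecutive G (fun n => g ^ n.choose i) ∈ F.pair.poly d
    cases i with
    | zero =>
      convert h1 using 1
      ext n <;> simp [consecutive]
    | succ i =>
      have h2 := ih F.pair i (1, g) ⟨one_mem _, by simpa using hg⟩
      convert mul_mem h1 h2 using 1
      ext n
      · simp [consecutive]
      · simp [consecutive, Nat.choose_succ_succ, ← pow_add, add_comm]

/-- The first nonzero Taylor coefficient: if `f d = 1`, the pair `(f d, f (d + 1))` in level `d` of
the pair filtration puts `f (d + 1)` in level `d + 1`. -/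
theorem apply_mem_term_of_mem_poly (d : ℕ) : ∀ {G : Type*} [Group G] (F : CommutatorFiltration G)
    (f : ℕ → G), f ∈ F.poly d → (∀ n < d, f n = 1) → f d ∈ F.term d := by
  induction d with
  | zero =>
    intro G _ F f hf _
    simp only [poly, Subgroup.mem_pi] at hf
    exact hf 0 trivial
  | succ d ih =>
    intro G _ F f hf h0
    have h := ih F.pair (consecutive G f) hf fun n hn => by
      simp [consecutive, h0 n (by omega), h0 (n + 1) (by omega)]
    have h2 := h.2
    simpa [consecutive, h0 d (by omega)] using h2

/-- A polynomial sequence with values in a subgroup of exponent `p` that vanishes at `0` and whose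
terms of order `p` are trivial also vanishes at `p`, if its linear coefficient is trivial. -/
theorem apply_prime_eq_one (F : CommutatorFiltration G) {p : ℕ} (hp : p.Prime)
    (hF : F.term p = ⊥) (N : Subgroup G) (hN : ∀ n ∈ N, n ^ p = 1) (f : ℕ → G)
    (hf : ∀ d, f ∈ F.poly d) (hfN : ∀ n, f n ∈ N) (h0 : f 0 = 1) (h1 : f 1 = 1) : f p = 1 := by
  have key : ∀ m, 2 ≤ m → m ≤ p → ∃ f' : ℕ → G, (∀ d, f' ∈ F.poly d) ∧ (∀ n, f' n ∈ N) ∧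
      (∀ n < m, f' n = 1) ∧ f' p = f p := by
    intro m hm
    induction m, hm using Nat.le_induction with
    | base =>
      intro _
      refine ⟨f, hf, hfN, fun n hn => ?_, rfl⟩
      interval_cases n <;> assumption
    | succ m hm ih =>
      intro hmp
      obtain ⟨f', hf', hfN', hv, hfp⟩ := ih (by omega)
      have hg := apply_mem_term_of_mem_poly m F f' (hf' m) hv
      -- Dividing out the Taylor term of degree `m` leaves the value at `p` unchanged: `p` divides
      -- `p.choose m` and `f' m` lies in `N`.
      refine ⟨(fun n => f' m ^ n.choose m)⁻¹ * f', fun d =>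
        mul_mem (inv_mem (choose_pow_mem_poly d F m _ hg)) (hf' d),
        fun n => mul_mem (inv_mem (pow_mem (hfN' m) _)) (hfN' n), fun n hn => ?_, ?_⟩
      · rcases Nat.lt_succ_iff_lt_or_eq.1 hn with h | rfl
        · simp [hv n h, Nat.choose_eq_zero_of_lt h]
        · simp
      · obtain ⟨k, hk⟩ := hp.dvd_choose_self (by omega : m ≠ 0) (by omega)
        simp [hk, pow_mul, hN _ (hfN' m), hfp]
  obtain ⟨f', hf', -, hv, hfp⟩ := key p hp.two_le le_rfl
  have := apply_mem_term_of_mem_poly p F f' (hf' p) hv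
  rw [hF, Subgroup.mem_bot] at this
  rw [← hfp, this]

end CommutatorFiltration

/-! ### The lower central series and `p`-th powers of products -/

theorem Subgroup.commutator_commutator_le_of_rotate {G : Type*} [Group G]
    {H₁ H₂ H₃ N : Subgroup G} [N.Normal] (h1 : ⁅⁅H₂, H₃⁆, H₁⁆ ≤ N) (h2 : ⁅⁅H₃, H₁⁆, H₂⁆ ≤ N) :
    ⁅⁅H₁, H₂⁆, H₃⁆ ≤ N := by
  have key : ∀ K : Subgroup G, K ≤ N ↔ K.map (QuotientGroup.mk' N) = ⊥ := by
    intro K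
    rw [Subgroup.map_eq_bot_iff, QuotientGroup.ker_mk']
  rw [key] at h1 h2 ⊢
  simp only [Subgroup.map_commutator] at h1 h2 ⊢
  exact Subgroup.commutator_commutator_eq_bot_of_rotate h1 h2

theorem Subgroup.commutator_lowerCentralSeries_le (G : Type*) [Group G] (n : ℕ) : ∀ m,
    ⁅(⊤ : Subgroup G).lowerCentralSeries m, (⊤ : Subgroup G).lowerCentralSeries n⁆ ≤
      (⊤ : Subgroup G).lowerCentralSeries (m + n + 1) := by
  induction n with
  | zero => exact fun m => le_rfl
  | succ n ih =>
    intro m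
    rw [Subgroup.lowerCentralSeries_succ _ n, Subgroup.commutator_comm]
    apply Subgroup.commutator_commutator_le_of_rotate
    · rw [Subgroup.commutator_comm ⊤, ← Subgroup.lowerCentralSeries_succ]
      exact (ih (m + 1)).trans_eq (by congr 1; ring)
    · exact Subgroup.commutator_mono (ih m) le_rfl

/-- The lower central series as a commutator filtration with `G_0 = G_1 = G`. -/
def CommutatorFiltration.lowerCentral (G : Type*) [Group G] : CommutatorFiltration G where
  term i := (⊤ : Subgroup G).lowerCentralSeries (i - 1)
  term_succ_le i := Subgroup.lowerCentralSeries_antitone _ (by omega)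
  commutator_le i j := (Subgroup.commutator_lowerCentralSeries_le G (j - 1) (i - 1)).trans
    (Subgroup.lowerCentralSeries_antitone _ (by omega))

/-- In a group of class less than `p`, the `p`-th power map is multiplicative on elements that
commute modulo a normal subgroup of exponent `p`. -/
theorem mul_pow_prime_of_commute_mod {G : Type*} [Group G] {p : ℕ} (hp : p.Prime)
    (hG : (⊤ : Subgroup G).lowerCentralSeries (p - 1) = ⊥) (N : Subgroup G) [N.Normal]
    (hN : ∀ n ∈ N, n ^ p = 1) {a b : G}
    (hab : Commute (a : G ⧸ N) (b : G ⧸ N)) : (a * b) ^ p = a ^ p * b ^ p := by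
  let F := CommutatorFiltration.lowerCentral G
  have hmem : ∀ (g : G) d, (fun n : ℕ => g ^ n) ∈ F.poly d := fun g d => by
    have := F.choose_pow_mem_poly d 1 g (Subgroup.mem_top g)
    simpa using this
  have := F.apply_prime_eq_one hp hG N hN
    -- The sequence `b⁻ⁿ a⁻ⁿ (ab)ⁿ` takes values in `N` because `a` and `b` commute modulo `N`.
    ((fun n => b ^ n)⁻¹ * (fun n => a ^ n)⁻¹ * fun n => (a * b) ^ n)
    (fun d => mul_mem (mul_mem (inv_mem (hmem b d)) (inv_mem (hmem a d))) (hmem _ d))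
    (fun n => by
      rw [← QuotientGroup.eq_one_iff]
      simp [hab.mul_pow, mul_assoc])
    (by simp) (by simp [mul_assoc])
  simp only [Pi.mul_apply, Pi.inv_apply, ← mul_inv_rev] at this
  exact (inv_mul_eq_one.1 this).symm

/-! ### Regular `p`-th powers -/

/-- The `p`-th power map of a group behaves as in a regular `p`-group. -/
structure IsPowRegular (p : ℕ) (G : Type*) [Group G] : Prop where
  mul_pow_eq : ∀ a s : G, s ^ p = 1 → (a * s) ^ p = a ^ p
  inv_mul_pow_eq_one : ∀ a b : G, a ^ p = b ^ p → (a⁻¹ * b) ^ p = 1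

theorem Subgroup.top_lowerCentralSeries_eq_bot_of_subtype {G : Type*} [Group G] {H : Subgroup G}
    {c : ℕ} (h : H.lowerCentralSeries c = ⊥) : (⊤ : Subgroup H).lowerCentralSeries c = ⊥ := by
  rw [← H.top_subtype_lowerCentralSeries, Subgroup.map_eq_bot_iff] at h
  rwa [Subgroup.ker_subtype, le_bot_iff] at h

/-- This lowers the class in the induction for regularity. Modulo the third term of the series the
commutator subgroup is central, so adjoining one element to it gives an abelian group. -/
theorem Subgroup.lowerCentralSeries_closure_insert_commutator_le {G : Type*} [Group G] (a : G) :
    ∀ i, (Subgroup.closure (insert a (_root_.commutator G : Set G))).lowerCentralSeries (i + 1) ≤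
      (⊤ : Subgroup G).lowerCentralSeries (i + 2) := by
  intro i
  induction i with
  | zero =>
    let N := (⊤ : Subgroup G).lowerCentralSeries 2
    have hcomm : ∀ k ∈ _root_.commutator G, ∀ g : G, (k : G ⧸ N) * (g : G ⧸ N) = g * k := by
      intro k hk g
      have : ⁅k, g⁆ ∈ N := Subgroup.commutator_mem_commutator
        (Subgroup.top_lowerCentralSeries_one (G := G) ▸ hk) (Subgroup.mem_top g)
      rw [← QuotientGroup.eq_one_iff] at this
      exact commutatorElement_eq_one_iff_mul_comm.1 this
    rw [Subgroup.lowerCentralSeries_succ, Subgroup.lowerCentralSeries_zero]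
    change _ ≤ N
    rw [← QuotientGroup.ker_mk' N, ← Subgroup.map_eq_bot_iff, Subgroup.map_commutator,
      Subgroup.commutator_self_eq_bot_iff, MonoidHom.map_closure]
    apply Subgroup.isMulCommutative_closure
    rintro _ ⟨u, hu, rfl⟩ _ ⟨v, hv, rfl⟩
    rcases hu with rfl | hu
    · rcases hv with rfl | hv
      · rfl
      · exact (hcomm v hv u).symm
    · exact hcomm u hu v
  | succ i ih => exact Subgroup.commutator_mono ih le_top

theorem IsPowRegular.of_comm {p : ℕ} {G : Type*} [Group G] (h : ∀ a b : G, Commute a b) :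
    IsPowRegular p G where
  mul_pow_eq a s hs := by rw [(h a s).mul_pow, hs, mul_one]
  inv_mul_pow_eq_one a b hab := by rw [(h _ b).mul_pow, inv_pow, hab, inv_mul_cancel]

/-- The elements of order dividing `p` of a normal subgroup. -/
def IsPowRegular.torsionIn {p : ℕ} {G : Type*} [Group G] (H : Subgroup G)
    (h : IsPowRegular p H) : Subgroup G where
  carrier := {k | k ∈ H ∧ k ^ p = 1}
  one_mem' := ⟨one_mem _, one_pow _⟩
  mul_mem' := fun {a b} ha hb => ⟨mul_mem ha.1 hb.1, by
    have := h.mul_pow_eq ⟨a, ha.1⟩ ⟨b, hb.1⟩ (Subtype.ext hb.2)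
    exact (congrArg Subtype.val this).trans ha.2⟩
  inv_mem' := fun ha => ⟨inv_mem ha.1, by rw [inv_pow, ha.2, inv_one]⟩

instance {p : ℕ} {G : Type*} [Group G] (H : Subgroup G) [hH : H.Normal]
    (h : IsPowRegular p H) : (h.torsionIn H).Normal where
  conj_mem k hk g := ⟨hH.conj_mem k hk.1 g, by rw [conj_pow, hk.2]; simp⟩

theorem commute_mk_of_commutator_mem {G : Type*} [Group G] (N : Subgroup G) [N.Normal] {a b : G}
    (h : ⁅a, b⁆ ∈ N) : Commute (a : G ⧸ N) (b : G ⧸ N) := by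
  rw [← QuotientGroup.eq_one_iff] at h
  exact commutatorElement_eq_one_iff_commute.1 h

/-- Nilpotent groups of class less than `p` have regular `p`-th powers. -/
theorem isPowRegular_of_lowerCentralSeries_eq_bot {p : ℕ} (hp : p.Prime) (c : ℕ) (hc : 1 ≤ c) :
    c < p → ∀ {G : Type*} [Group G], (⊤ : Subgroup G).lowerCentralSeries c = ⊥ →
      IsPowRegular p G := by
  induction c, hc using Nat.le_induction with
  | base =>
    intro _ G _ h
    refine IsPowRegular.of_comm fun a b => ?_
    rw [← commutatorElement_eq_one_iff_commute, ← Subgroup.mem_bot, ← h]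
    exact Subgroup.commutator_mem_commutator (Subgroup.mem_top a) (Subgroup.mem_top b)
  | succ c hc ih =>
    intro hcp G _ hG
    let M (a : G) := Subgroup.closure (insert a (commutator G : Set G))
    have hle : ∀ a, commutator G ≤ M a := fun a k hk => Subgroup.subset_closure (Or.inr hk)
    have hM' : ∀ a, (M a).lowerCentralSeries c = ⊥ := fun a => by
      obtain ⟨c, rfl⟩ := Nat.exists_eq_add_of_le' hc
      exact le_bot_iff.1 ((Subgroup.lowerCentralSeries_closure_insert_commutator_le a c).trans_eq hG)
    have hM : ∀ a, IsPowRegular p (M a) := fun a =>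
      ih (by omega) (Subgroup.top_lowerCentralSeries_eq_bot_of_subtype (hM' a))
    have hC : IsPowRegular p (commutator G) :=
      ih (by omega) (Subgroup.top_lowerCentralSeries_eq_bot_of_subtype
        (le_bot_iff.1 ((Subgroup.lowerCentralSeries_mono c (hle 1)).trans_eq (hM' 1))))
    have hmem : ∀ a b : G, ⁅a, b⁆ ∈ commutator G := fun a b =>
      Subgroup.commutator_mem_commutator (Subgroup.mem_top a) (Subgroup.mem_top b)
    have hconj : ∀ a g : G, g * a * g⁻¹ ∈ M a := fun a g => by
      have : g * a * g⁻¹ = ⁅g, a⁆ * a := by simp [commutatorElement_def]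
      rw [this]
      exact mul_mem (hle a (hmem _ _)) (Subgroup.subset_closure (Or.inl rfl))
    have hself : ∀ a : G, a ∈ M a := fun a => Subgroup.subset_closure (Or.inl rfl)
    have hbot : (⊤ : Subgroup G).lowerCentralSeries (p - 1) = ⊥ :=
      le_bot_iff.1 ((Subgroup.lowerCentralSeries_antitone _ (by omega)).trans_eq hG)
    have hmul : ∀ a b : G, ⁅a, b⁆ ^ p = 1 → (a * b) ^ p = a ^ p * b ^ p := fun a b hab =>
      mul_pow_prime_of_commute_mod hp hbot (hC.torsionIn _) (fun n hn => hn.2)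
        (commute_mk_of_commutator_mem _ ⟨hmem a b, hab⟩)
    constructor
    · intro a s hs
      -- `[a, s]` is the product of `a s a⁻¹` and `s⁻¹`, both in `M s` and with trivial `p`-th
      -- power.
      have h1 := (hM s).mul_pow_eq ⟨a * s * a⁻¹, hconj s a⟩ ⟨s⁻¹, inv_mem (hself s)⟩
        (Subtype.ext (by simp [hs]))
      have h2 : ⁅a, s⁆ ^ p = 1 := (congrArg Subtype.val h1).trans (by simp [conj_pow, hs])
      rw [hmul a s h2, hs, mul_one]
    · intro a b hab
      -- `b` commutes with `b ^ p = a ^ p`, so `a` and `b a b⁻¹` have equal `p`-th powers;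
      -- regularity of `M a` then handles `[a⁻¹, b]`.
      have h1 := (hM a).inv_mul_pow_eq_one ⟨a, hself a⟩ ⟨b * a * b⁻¹, hconj a b⟩
        (Subtype.ext (by
          change a ^ p = (b * a * b⁻¹) ^ p
          rw [conj_pow, hab, mul_inv_eq_of_eq_mul]
          exact (Commute.refl b).pow_right p))
      have h2 : (a⁻¹ * (b * a * b⁻¹)) ^ p = 1 := congrArg Subtype.val h1
      have h3 : ⁅a⁻¹, b⁆ ^ p = 1 := by simpa [commutatorElement_def, mul_assoc] using h2
      rw [hmul _ _ h3, inv_pow, hab, inv_mul_cancel]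

/-- In a group with regular `p`-th powers, the `p`-th power of a commutator depends only on the
`p`-th powers of its arguments. -/
theorem IsPowRegular.commutator_pow_eq {p : ℕ} {G : Type*} [Group G] (h : IsPowRegular p G)
    {a a' b b' : G} (ha : a ^ p = a' ^ p) (hb : b ^ p = b' ^ p) :
    (a⁻¹ * b⁻¹ * a * b) ^ p = (a'⁻¹ * b'⁻¹ * a' * b') ^ p := by
  let N : Subgroup G :=
    { carrier := {k | k ^ p = 1}
      one_mem' := one_pow _
      mul_mem' := fun {u v} hu hv => (h.mul_pow_eq u v hv).trans hu
      inv_mem' := fun {u} hu => by simp_all }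
  have : N.Normal := ⟨fun k hk g => by
    change (g * k * g⁻¹) ^ p = 1
    rw [conj_pow, show k ^ p = 1 from hk]; simp⟩
  have h1 : (a : G ⧸ N) = a' := QuotientGroup.eq.2 (h.inv_mul_pow_eq_one a a' ha)
  have h2 : (b : G ⧸ N) = b' := QuotientGroup.eq.2 (h.inv_mul_pow_eq_one b b' hb)
  have h3 : ((a⁻¹ * b⁻¹ * a * b : G) : G ⧸ N) = (a'⁻¹ * b'⁻¹ * a' * b' : G) := by
    simp [h1, h2]
  have h4 := h.mul_pow_eq (a⁻¹ * b⁻¹ * a * b) _ (QuotientGroup.eq.1 h3)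
  rw [← h4, mul_inv_cancel_left]

/-! ### Heisenberg groups -/

/-- The Heisenberg group over `R`: triples with
`(a, b, c) (a', b', c') = (a + a', b + b', c + c' + a b')`. -/
@[ext]
structure Heisenberg (R : Type*) where
  a : R
  b : R
  c : R

namespace Heisenberg

section Group

variable {R S : Type*} [CommRing R] [CommRing S]

instance : Mul (Heisenberg R) := ⟨fun s t => ⟨s.a + t.a, s.b + t.b, s.c + t.c + s.a * t.b⟩⟩
instance : One (Heisenberg R) := ⟨⟨0, 0, 0⟩⟩
instance : Inv (Heisenberg R) := ⟨fun s => ⟨-s.a, -s.b, -s.c + s.a * s.b⟩⟩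

@[simp] theorem mul_a (s t : Heisenberg R) : (s * t).a = s.a + t.a := rfl
@[simp] theorem mul_b (s t : Heisenberg R) : (s * t).b = s.b + t.b := rfl
@[simp] theorem mul_c (s t : Heisenberg R) : (s * t).c = s.c + t.c + s.a * t.b := rfl
@[simp] theorem one_a : (1 : Heisenberg R).a = 0 := rfl
@[simp] theorem one_b : (1 : Heisenberg R).b = 0 := rfl
@[simp] theorem one_c : (1 : Heisenberg R).c = 0 := rfl
@[simp] theorem inv_a (s : Heisenberg R) : (s⁻¹).a = -s.a := rfl
@[simp] theorem inv_b (s : Heisenberg R) : (s⁻¹).b = -s.b := rfl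
@[simp] theorem inv_c (s : Heisenberg R) : (s⁻¹).c = -s.c + s.a * s.b := rfl

instance : Group (Heisenberg R) :=
  Group.ofLeftAxioms (fun s t r => by ext <;> simp <;> ring) (fun s => by ext <;> simp)
    (fun s => by ext <;> simp)

theorem pow_eq (s : Heisenberg R) (h : s.a * s.b = 0) (n : ℕ) :
    s ^ n = ⟨n * s.a, n * s.b, n * s.c⟩ := by
  induction n with
  | zero => ext <;> simp
  | succ n ih =>
    rw [pow_succ, ih]
    ext
    · simp; ring
    · simp; ring
    · simp [mul_assoc, h]; ring

/-- The map of Heisenberg groups induced by a ring homomorphism. -/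
def map (f : R →+* S) : Heisenberg R →* Heisenberg S where
  toFun s := ⟨f s.a, f s.b, f s.c⟩
  map_one' := by ext <;> simp
  map_mul' s t := by ext <;> simp

/-- The projection of the Heisenberg group to its abelianization. -/
def proj (R : Type*) [CommRing R] : Heisenberg R →* Multiplicative (R × R) where
  toFun s := Multiplicative.ofAdd (s.a, s.b)
  map_one' := rfl
  map_mul' _ _ := rfl

theorem ker_proj_le_center : (proj R).ker ≤ Subgroup.center (Heisenberg R) := by
  intro s hs
  have h : (s.a, s.b) = (0, 0) := hs
  rw [Prod.mk.injEq] at h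
  rw [Subgroup.mem_center_iff]
  intro t
  ext
  · simp [add_comm]
  · simp [add_comm]
  · simp [h.1, h.2, add_comm]

end Group

theorem mem_nilpotent_two (R : Type u) [CommRing R] :
    (GroupVariety.nilpotent.{u} 2).Mem (Heisenberg R) :=
  ⟨Subgroup.isNilpotent_of_ker_le_center (proj R) ker_proj_le_center,
    (Group.nilpotencyClass_le_of_ker_le_center (proj R) ker_proj_le_center).trans
      (Nat.succ_le_succ CommGroup.nilpotencyClass_le_one)⟩

section Lift

variable {G : Type*} [Group G] {u v : G}

theorem zpow_mul_zpow_eq (hu : Commute (u⁻¹ * v⁻¹ * u * v) u) (hv : Commute (u⁻¹ * v⁻¹ * u * v) v)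
    (m n : ℤ) : u ^ m * v ^ n = v ^ n * u ^ m * (u⁻¹ * v⁻¹ * u * v) ^ (m * n) := by
  set z := u⁻¹ * v⁻¹ * u * v with hz
  have h1 : v⁻¹ * u * v = u * z := by rw [hz]; group
  have h2 : v⁻¹ * u ^ m * v = u ^ m * z ^ m := by
    have := conj_zpow (a := v⁻¹) (b := u) (i := m)
    rw [inv_inv] at this
    rw [← this, h1, hu.symm.mul_zpow]
  have h3 : u ^ m * v * (u ^ m)⁻¹ = v * z ^ m := by
    rw [mul_inv_eq_iff_eq_mul, mul_assoc, ← (hu.symm.zpow_zpow m m).eq, ← h2]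
    group
  have h4 : u ^ m * v ^ n * (u ^ m)⁻¹ = v ^ n * z ^ (m * n) := by
    rw [← conj_zpow, h3, (hv.symm.zpow_right m).mul_zpow, zpow_mul]
  rw [mul_inv_eq_iff_eq_mul] at h4
  rw [h4, mul_assoc, mul_assoc, (hu.zpow_zpow _ _).eq]

/-- The homomorphism from the integral Heisenberg group given by two elements that commute with
their commutator. -/
def lift (hu : Commute (u⁻¹ * v⁻¹ * u * v) u) (hv : Commute (u⁻¹ * v⁻¹ * u * v) v) :
    Heisenberg (ULift.{u} ℤ) →* G where
  -- With `v` before `u`, moving `u ^ a` past `v ^ b'` creates `z ^ (a * b')`, the cocycle of the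
  -- Heisenberg product.
  toFun s := v ^ s.b.down * u ^ s.a.down * (u⁻¹ * v⁻¹ * u * v) ^ s.c.down
  map_one' := by simp
  map_mul' s t := by
    have h := zpow_mul_zpow_eq hu hv s.a.down t.b.down
    set z := u⁻¹ * v⁻¹ * u * v
    have h1 := (hv.zpow_zpow s.c.down t.b.down).eq
    have h2 := (hu.zpow_zpow s.c.down t.a.down).eq
    have h3 := (hu.zpow_zpow (s.a.down * t.b.down) t.a.down).eq
    simp only [mul_a, mul_b, mul_c, ULift.add_down, ULift.mul_down]
    symm
    calc v ^ s.b.down * u ^ s.a.down * z ^ s.c.down * (v ^ t.b.down * u ^ t.a.down * z ^ t.c.down)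
        = v ^ s.b.down * u ^ s.a.down * (z ^ s.c.down * v ^ t.b.down) * u ^ t.a.down
          * z ^ t.c.down := by simp only [mul_assoc]
      _ = v ^ s.b.down * (u ^ s.a.down * v ^ t.b.down) * (z ^ s.c.down * u ^ t.a.down)
          * z ^ t.c.down := by rw [h1]; simp only [mul_assoc]
      _ = v ^ s.b.down * v ^ t.b.down * u ^ s.a.down * (z ^ (s.a.down * t.b.down) * u ^ t.a.down)
          * z ^ s.c.down * z ^ t.c.down := by rw [h, h2]; simp only [mul_assoc]
      _ = v ^ (s.b.down + t.b.down) * u ^ (s.a.down + t.a.down)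
          * z ^ (s.c.down + t.c.down + s.a.down * t.b.down) := by
        rw [h3, add_comm (s.c.down + t.c.down), zpow_add, zpow_add, zpow_add, zpow_add]
        simp only [mul_assoc]

end Lift

end Heisenberg

/-! ### Relatively free groups and central commutators -/

namespace GroupVariety

variable {V : GroupVariety.{u}} {X : Type u}

/-- The universal property of the relatively free groups. -/
def lift (V : GroupVariety.{u}) {C : Type u} [Group C] (hC : V.Mem C) (f : X → C) :
    V.RelFree X →* C :=
  QuotientGroup.lift _ (FreeGroup.lift f) fun _ hw => hw C hC _

@[simp] theorem lift_gen {C : Type u} [Group C] (hC : V.Mem C) (f : X → C) (i : X) :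
    V.lift hC f (V.gen i) = f i :=
  FreeGroup.lift_apply_of

theorem relFree_hom_ext {C : Type*} [Group C] {f g : V.RelFree X →* C}
    (h : ∀ i, f (V.gen i) = g (V.gen i)) : f = g :=
  QuotientGroup.monoidHom_ext _ (FreeGroup.ext_hom _ _ h)

theorem mem_of_mulEquiv {G K : Type u} [Group G] [Group K] (e : G ≃* K) (h : V.Mem G) : V.Mem K :=
  V.image_mem G K e.toMonoidHom e.surjective h

/-- Each word that is not a law is detected in some group of `V`; the product of these groups over
all such words contains the relatively free group. -/
theorem mem_relFree (V : GroupVariety.{u}) (X : Type u) : V.Mem (V.RelFree X) := by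
  have h : ∀ w : {w // w ∉ V.laws X}, ∃ (C : Type u) (_ : Group C),
      V.Mem C ∧ ∃ f : FreeGroup X →* C, f w ≠ 1 := by
    rintro ⟨w, hw⟩
    by_contra hcon
    push Not at hcon
    exact hw fun C i hC f => hcon C i hC f
  choose C inst hC f hf using h
  let φ : V.RelFree X →* ∀ w, C w :=
    QuotientGroup.lift _ (MonoidHom.pi f) fun w hw => funext fun i => hw _ (hC i) (f i)
  have hφ : Function.Injective φ := by
    rw [injective_iff_map_eq_one]
    intro q
    induction q using QuotientGroup.induction_on with
    | H w =>
      intro hw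
      rw [QuotientGroup.eq_one_iff]
      by_contra hcon
      exact hf ⟨w, hcon⟩ (congrFun hw ⟨w, hcon⟩)
  exact mem_of_mulEquiv (MonoidHom.ofInjective hφ).symm
    (V.subgroup_mem _ _ (V.pi_mem _ _ hC))

theorem isNilpotent_relFree_of_finite (hln : V.IsLocallyNilpotent) [Finite X] :
    Group.IsNilpotent (V.RelFree X) :=
  hln _ (V.mem_relFree X) inferInstance

end GroupVariety

/-- Take `u` in the second centre but not in the centre, and `v` not commuting with it. -/
theorem Group.IsNilpotent.exists_commutator_mem_center {G : Type*} [Group G]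
    [Group.IsNilpotent G] (h : ∃ a b : G, a * b ≠ b * a) :
    ∃ u v : G, u⁻¹ * v⁻¹ * u * v ≠ 1 ∧ u⁻¹ * v⁻¹ * u * v ∈ Subgroup.center G := by
  obtain ⟨a, b, hab⟩ := h
  have : Nontrivial (G ⧸ Subgroup.center G) := by
    rw [QuotientGroup.nontrivial_iff]
    intro ht
    exact hab (Subgroup.mem_center_iff.1 (ht ▸ Subgroup.mem_top b : b ∈ Subgroup.center G) a)
  obtain ⟨⟨q, hq⟩, hne⟩ := Subgroup.ne_bot_iff_exists_ne_one.1
    (Group.IsNilpotent.center_ne_bot (G := G ⧸ Subgroup.center G))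
  have hq1 : ¬ q = 1 := fun h => hne (Subtype.ext h)
  obtain ⟨u, hu⟩ := QuotientGroup.mk_surjective q
  rw [← hu, QuotientGroup.eq_one_iff, Subgroup.mem_center_iff] at hq1
  push Not at hq1
  obtain ⟨v, hv⟩ := hq1
  refine ⟨u, v, fun h => hv ?_, ?_⟩
  · rw [mul_assoc, mul_assoc, inv_mul_eq_one, eq_inv_mul_iff_mul_eq] at h
    exact h
  · rw [← QuotientGroup.eq_one_iff]
    have := Subgroup.mem_center_iff.1 hq (v : G ⧸ Subgroup.center G)
    rw [← hu] at this
    simp [mul_assoc, ← this]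

theorem Group.commutator_mem_center_of_nilpotencyClass_le_two {G : Type*} [Group G]
    [Group.IsNilpotent G] (h : Group.nilpotencyClass G ≤ 2) (u v : G) :
    u⁻¹ * v⁻¹ * u * v ∈ Subgroup.center G := by
  rw [← Subgroup.lowerCentralSeries_eq_bot_iff_nilpotencyClass_le,
    Subgroup.lowerCentralSeries_succ, Subgroup.commutator_top_right_eq_bot_iff_le_center] at h
  have : ⁅u⁻¹, v⁻¹⁆ ∈ (⊤ : Subgroup G).lowerCentralSeries 1 :=
    Subgroup.commutator_mem_commutator (Subgroup.mem_top _) (Subgroup.mem_top _)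
  simpa [commutatorElement_def] using h this

/-! ### The free class two group in Heisenberg coordinates -/

namespace FreeClassTwo

theorem mem_nilpotent_two : (GroupVariety.nilpotent.{u} 2).Mem FreeClassTwo.{u} :=
  GroupVariety.mem_relFree _ _

theorem commute_commutator (w : FreeClassTwo.{u}) : Commute (x⁻¹ * y⁻¹ * x * y) w :=
  have := mem_nilpotent_two.1
  (Subgroup.mem_center_iff.1
    (Group.commutator_mem_center_of_nilpotencyClass_le_two mem_nilpotent_two.2 x y) w).symm

theorem hom_ext {C : Type*} [Group C] {f g : FreeClassTwo.{u} →* C} (hx : f x = g x)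
    (hy : f y = g y) : f = g :=
  GroupVariety.relFree_hom_ext fun ⟨i⟩ => by
    fin_cases i
    · exact hx
    · exact hy

/-- The representation of the free class two group by Heisenberg matrices over `R`. -/
def toHeisenberg (R : Type u) [CommRing R] : FreeClassTwo.{u} →* Heisenberg R :=
  GroupVariety.lift _ (Heisenberg.mem_nilpotent_two R) fun i => ![⟨1, 0, 0⟩, ⟨0, 1, 0⟩] i.down

@[simp] theorem toHeisenberg_x (R : Type u) [CommRing R] : toHeisenberg R x = ⟨1, 0, 0⟩ :=
  GroupVariety.lift_gen _ _ _

@[simp] theorem toHeisenberg_y (R : Type u) [CommRing R] : toHeisenberg R y = ⟨0, 1, 0⟩ :=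
  GroupVariety.lift_gen _ _ _

theorem toHeisenberg_commutator (R : Type u) [CommRing R] :
    toHeisenberg R (x⁻¹ * y⁻¹ * x * y) = ⟨0, 0, 1⟩ := by
  ext <;> simp

section LiftPair

variable {G : Type*} [Group G] {u v : G}

/-- The homomorphism given by two elements that commute with their commutator. -/
def liftPair (hu : Commute (u⁻¹ * v⁻¹ * u * v) u) (hv : Commute (u⁻¹ * v⁻¹ * u * v) v) :
    FreeClassTwo.{u} →* G :=
  (Heisenberg.lift hu hv).comp (toHeisenberg (ULift.{u} ℤ))

variable (hu : Commute (u⁻¹ * v⁻¹ * u * v) u) (hv : Commute (u⁻¹ * v⁻¹ * u * v) v)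

theorem liftPair_apply (w : FreeClassTwo.{u}) :
    liftPair hu hv w = v ^ (toHeisenberg (ULift.{u} ℤ) w).b.down *
      u ^ (toHeisenberg (ULift.{u} ℤ) w).a.down *
      (u⁻¹ * v⁻¹ * u * v) ^ (toHeisenberg (ULift.{u} ℤ) w).c.down :=
  rfl

@[simp] theorem liftPair_x : liftPair hu hv x = u := by
  simp [liftPair_apply]

@[simp] theorem liftPair_y : liftPair hu hv y = v := by
  simp [liftPair_apply]

end LiftPair

theorem eq_normal_form (w : FreeClassTwo.{u}) :
    w = y ^ (toHeisenberg (ULift.{u} ℤ) w).b.down * x ^ (toHeisenberg (ULift.{u} ℤ) w).a.down *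
      (x⁻¹ * y⁻¹ * x * y) ^ (toHeisenberg (ULift.{u} ℤ) w).c.down := by
  rw [← liftPair_apply (commute_commutator x) (commute_commutator y)]
  have : liftPair (commute_commutator x) (commute_commutator y) = MonoidHom.id FreeClassTwo.{u} :=
    hom_ext (by simp) (by simp)
  rw [this, MonoidHom.id_apply]

theorem toHeisenberg_eq_map (R : Type u) [CommRing R] (w : FreeClassTwo.{u}) :
    toHeisenberg R w = Heisenberg.map
      ((Int.castRingHom R).comp (ULift.ringEquiv.{0, u} (R := ℤ) : ULift.{u} ℤ →+* ℤ))
      (toHeisenberg (ULift.{u} ℤ) w) := by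
  have : toHeisenberg R = (Heisenberg.map
      ((Int.castRingHom R).comp (ULift.ringEquiv.{0, u} (R := ℤ) : ULift.{u} ℤ →+* ℤ))).comp
      (toHeisenberg (ULift.{u} ℤ)) :=
    hom_ext (by ext <;> simp [Heisenberg.map]) (by ext <;> simp [Heisenberg.map])
  exact DFunLike.congr_fun this w

/-- The triples `(a, b, c)` with `p ∣ a`, `p ∣ b` and `p ^ 2 ∣ c`. -/
def divisibleTriples (p : ℕ) : Subgroup (Heisenberg (ULift.{u} ℤ)) where
  carrier := {s | (p : ℤ) ∣ s.a.down ∧ (p : ℤ) ∣ s.b.down ∧ (p : ℤ) ^ 2 ∣ s.c.down}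
  one_mem' := by simp
  mul_mem' := fun hs ht => ⟨dvd_add hs.1 ht.1, dvd_add hs.2.1 ht.2.1,
    dvd_add (dvd_add hs.2.2 ht.2.2) (pow_two (p : ℤ) ▸ mul_dvd_mul hs.1 ht.2.1)⟩
  inv_mem' := fun hs => ⟨(dvd_neg).2 hs.1, (dvd_neg).2 hs.2.1,
    dvd_add ((dvd_neg).2 hs.2.2) (pow_two (p : ℤ) ▸ mul_dvd_mul hs.1 hs.2.1)⟩

/-- The subgroup `divisibleTriples p` contains the images of `x ^ p` and `y ^ p`, while `[x, y] ^ p`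
has last coordinate `p`, not divisible by `p ^ 2`. -/
theorem commutator_pow_notMem_powers {p : ℕ} (hp : p.Prime) :
    (x⁻¹ * y⁻¹ * x * y) ^ p ∉ powers.{u} p := by
  intro h
  have hle : powers.{u} p ≤ (divisibleTriples p).comap (toHeisenberg (ULift.{u} ℤ)) := by
    rw [powers, Subgroup.closure_le]
    rintro _ (rfl | rfl)
    · simp [Heisenberg.pow_eq, divisibleTriples]
    · simp [Heisenberg.pow_eq, divisibleTriples]
  have h2 := (hle h).2.2
  rw [map_pow, toHeisenberg_commutator, Heisenberg.pow_eq _ (by simp)] at h2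
  simp only [mul_one, ULift.down_natCast] at h2
  have h3 : p ^ 2 ∣ p ^ 1 := by rw [pow_one]; exact_mod_cast h2
  have := (Nat.pow_dvd_pow_iff_le_right hp.one_lt).1 h3
  omega

theorem mem_powersComm_of_toHeisenberg_eq_one {p : ℕ} {w : FreeClassTwo.{u}}
    (hw : toHeisenberg (ULift.{u} (ZMod p)) w = 1) : w ∈ powersComm.{u} p := by
  rw [toHeisenberg_eq_map] at hw
  have hd : ∀ n : ℤ, ((n : ULift.{u} (ZMod p)) = 0) → (p : ℤ) ∣ n := fun n hn =>
    (ZMod.intCast_zmod_eq_zero_iff_dvd n p).1 (congrArg ULift.down hn)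
  have hmem : ∀ {g : FreeClassTwo.{u}} {n : ℤ}, g ^ p ∈ powersComm.{u} p → (p : ℤ) ∣ n →
      g ^ n ∈ powersComm.{u} p := by
    rintro g _ hg ⟨k, rfl⟩
    rw [zpow_mul, zpow_natCast]
    exact zpow_mem hg k
  rw [eq_normal_form w]
  refine mul_mem (mul_mem ?_ ?_) ?_
  · exact hmem (Subgroup.subset_closure (by simp)) (hd _ (congrArg Heisenberg.b hw))
  · exact hmem (Subgroup.subset_closure (by simp)) (hd _ (congrArg Heisenberg.a hw))
  · exact hmem (Subgroup.subset_closure (by simp)) (hd _ (congrArg Heisenberg.c hw))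

theorem toHeisenberg_eq_one_of_mem_powers {p : ℕ} {w : FreeClassTwo.{u}} (hw : w ∈ powers.{u} p) :
    toHeisenberg (ULift.{u} (ZMod p)) w = 1 := by
  have hle : powers.{u} p ≤ (toHeisenberg (ULift.{u} (ZMod p))).ker := by
    rw [powers, Subgroup.closure_le]
    rintro _ (rfl | rfl)
    · simp [MonoidHom.mem_ker, Heisenberg.pow_eq]; rfl
    · simp [MonoidHom.mem_ker, Heisenberg.pow_eq]; rfl
  exact hle hw

end FreeClassTwo

/-! ### Laws of the variety and the two bounds on the dominion -/

namespace GroupVariety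

variable {V : GroupVariety.{u}}

theorem IsNonabelian.exists_relFree (hna : V.IsNonabelian) :
    ∃ a b : V.RelFree (ULift.{u} (Fin 2)), a * b ≠ b * a := by
  obtain ⟨G, _, hG, a, b, hab⟩ := hna
  refine ⟨V.gen ⟨0⟩, V.gen ⟨1⟩, fun h => hab ?_⟩
  simpa using congrArg (V.lift hG fun i : ULift.{u} (Fin 2) => ![a, b] i.down) h

/-- The laws in two variables of a nonabelian, torsion free, locally nilpotent variety hold in
groups of class two. -/
theorem laws_le_laws_nilpotent_two (hna : V.IsNonabelian) (htf : V.IsTorsionFree)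
    (hln : V.IsLocallyNilpotent) :
    V.laws (ULift.{u} (Fin 2)) ≤ (nilpotent.{u} 2).laws (ULift.{u} (Fin 2)) := by
  intro w hw
  have hnil := isNilpotent_relFree_of_finite (X := ULift.{u} (Fin 2)) hln
  obtain ⟨u, v, huv, hc⟩ := Group.IsNilpotent.exists_commutator_mem_center hna.exists_relFree
  let q : FreeClassTwo.{u} := QuotientGroup.mk w
  have hq : ∀ φ : FreeClassTwo.{u} →* V.RelFree (ULift.{u} (Fin 2)), φ q = 1 := fun φ =>
    hw _ (V.mem_relFree _) (φ.comp (QuotientGroup.mk' _))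
  have htor : ∀ (g : V.RelFree (ULift.{u} (Fin 2))) (n : ℤ), g ≠ 1 → g ^ n = 1 → n = 0 := by
    intro g n hg h
    by_contra hn
    exact hg (htf _ g (isOfFinOrder_iff_zpow_eq_one.2 ⟨n, hn, h⟩))
  have hcomm : ∀ g, Commute (u⁻¹ * v⁻¹ * u * v) g := fun g =>
    (Subgroup.mem_center_iff.1 hc g).symm
  have hu : u ≠ 1 := by rintro rfl; simp at huv
  have hv : v ≠ 1 := by rintro rfl; simp at huv
  have ha : (FreeClassTwo.toHeisenberg (ULift.{u} ℤ) q).a.down = 0 := by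
    -- Sending the generators to `(u, 1)`, `(1, v)` and `(u, v)` isolates the three exponents of the
    -- normal form one at a time.
    have := hq (FreeClassTwo.liftPair (u := u) (v := 1) (by simp) (by simp))
    rw [FreeClassTwo.liftPair_apply] at this
    exact htor u _ hu (by simpa using this)
  have hb : (FreeClassTwo.toHeisenberg (ULift.{u} ℤ) q).b.down = 0 := by
    have := hq (FreeClassTwo.liftPair (u := 1) (v := v) (by simp) (by simp))
    rw [FreeClassTwo.liftPair_apply] at this
    exact htor v _ hv (by simpa using this)
  have hcz : (FreeClassTwo.toHeisenberg (ULift.{u} ℤ) q).c.down = 0 := by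
    have := hq (FreeClassTwo.liftPair (hcomm u) (hcomm v))
    rw [FreeClassTwo.liftPair_apply, ha, hb] at this
    exact htor _ _ huv (by simpa using this)
  have h1 : q = 1 := by
    rw [FreeClassTwo.eq_normal_form q, ha, hb, hcz]
    simp
  exact (QuotientGroup.eq_one_iff w).1 h1

theorem mem_freeClassTwo (hna : V.IsNonabelian) (htf : V.IsTorsionFree)
    (hln : V.IsLocallyNilpotent) : V.Mem FreeClassTwo.{u} := by
  have hle := laws_le_laws_nilpotent_two hna htf hln
  refine V.image_mem _ _ (QuotientGroup.map (V.laws _) _ (MonoidHom.id _) hle) ?_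
    (V.mem_relFree (ULift.{u} (Fin 2)))
  exact QuotientGroup.map_surjective_of_surjective _ _ _
    (QuotientGroup.mk_surjective.comp Function.surjective_id) hle

theorem le_dominion {A : Type u} [Group A] (H : Subgroup A) : H ≤ V.dominion H :=
  fun h hh _ _ _ _ _ hfg => hfg h hh

theorem commutator_pow_mem_dominion (p : ℕ) (hp : p.Prime)
    (hnil : Group.IsNilpotent (V.RelFree (ULift.{u} (Fin 4))))
    (hlt : Group.nilpotencyClass (V.RelFree (ULift.{u} (Fin 4))) < p)
    {A : Type u} [Group A] (a b : A) :
    (a⁻¹ * b⁻¹ * a * b) ^ p ∈ V.dominion (Subgroup.closure {a ^ p, b ^ p}) := by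
  intro C _ hC f g hfg
  let φ := V.lift hC fun i : ULift.{u} (Fin 4) => ![f a, g a, f b, g b] i.down
  have hcl : Group.nilpotencyClass φ.range ≤ p - 1 :=
    (Group.nilpotencyClass_le_of_surjective _ φ.rangeRestrict_surjective).trans (by omega)
  have hn : Group.IsNilpotent φ.range :=
    Group.nilpotent_of_surjective _ φ.rangeRestrict_surjective
  -- The bound `p - 1` is used instead of the actual class, as the regularity result needs an
  -- exponent at least `1`.
  have hreg := isPowRegular_of_lowerCentralSeries_eq_bot hp (p - 1)
    (by have := hp.two_le; omega) (by have := hp.pos; omega)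
    (Subgroup.lowerCentralSeries_eq_bot_iff_nilpotencyClass_le.2 hcl)
  have hmem : ∀ i, ![f a, g a, f b, g b] i ∈ φ.range := fun i => ⟨V.gen ⟨i⟩, by simp [φ]⟩
  have ha : f a ^ p = g a ^ p := by
    simpa using hfg (a ^ p) (Subgroup.subset_closure (by simp))
  have hb : f b ^ p = g b ^ p := by
    simpa using hfg (b ^ p) (Subgroup.subset_closure (by simp))
  have key := hreg.commutator_pow_eq (a := ⟨f a, hmem 0⟩) (a' := ⟨g a, hmem 1⟩)
    (b := ⟨f b, hmem 2⟩) (b' := ⟨g b, hmem 3⟩) (Subtype.ext ha) (Subtype.ext hb)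
  simpa using congrArg Subtype.val key

theorem dominion_powers_le_powersComm (hF : V.Mem FreeClassTwo.{u}) (p : ℕ) :
    V.dominion (FreeClassTwo.powers.{u} p) ≤ FreeClassTwo.powersComm.{u} p := by
  intro w hw
  let ψ := FreeClassTwo.toHeisenberg (ULift.{u} (ZMod p))
  -- Reduction mod `p` and the trivial homomorphism agree on `⟨x ^ p, y ^ p⟩`, so the dominion lies
  -- in the kernel of the reduction.
  have := hw ψ.range (V.image_mem _ _ _ ψ.rangeRestrict_surjective hF) ψ.rangeRestrict 1
    fun h hh => Subtype.ext (FreeClassTwo.toHeisenberg_eq_one_of_mem_powers hh)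
  exact FreeClassTwo.mem_powersComm_of_toHeisenberg_eq_one (congrArg Subtype.val this)

end GroupVariety

theorem theorem9p88 (V : GroupVariety.{u}) (hna : V.IsNonabelian) (htf : V.IsTorsionFree)
    (hln : V.IsLocallyNilpotent) :
    V.HasNontrivialDominions ∧
    V.Mem FreeClassTwo.{u} ∧
    Group.IsNilpotent (V.RelFree (ULift.{u} (Fin 4))) ∧
    ∀ p : ℕ, p.Prime → Group.nilpotencyClass (V.RelFree (ULift.{u} (Fin 4))) < p →
      FreeClassTwo.powers.{u} p < V.dominion (FreeClassTwo.powers.{u} p) ∧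
      V.dominion (FreeClassTwo.powers.{u} p) = FreeClassTwo.powersComm.{u} p := by
  have hF := GroupVariety.mem_freeClassTwo hna htf hln
  have hnil := GroupVariety.isNilpotent_relFree_of_finite (X := ULift.{u} (Fin 4)) hln
  have key : ∀ p : ℕ, p.Prime → Group.nilpotencyClass (V.RelFree (ULift.{u} (Fin 4))) < p →
      FreeClassTwo.powers.{u} p < V.dominion (FreeClassTwo.powers.{u} p) ∧
      V.dominion (FreeClassTwo.powers.{u} p) = FreeClassTwo.powersComm.{u} p := by
    intro p hp hlt
    have hz := GroupVariety.commutator_pow_mem_dominion p hp hnil hlt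
      FreeClassTwo.x.{u} FreeClassTwo.y
    refine ⟨lt_of_le_of_ne (GroupVariety.le_dominion _) fun h =>
      FreeClassTwo.commutator_pow_notMem_powers hp (h.symm.le hz),
      le_antisymm (GroupVariety.dominion_powers_le_powersComm hF p) ?_⟩
    rw [FreeClassTwo.powersComm, Subgroup.closure_le]
    rintro _ (rfl | rfl | rfl)
    · exact GroupVariety.le_dominion _ (Subgroup.subset_closure (by simp))
    · exact GroupVariety.le_dominion _ (Subgroup.subset_closure (by simp))
    · exact hz
  obtain ⟨p, hle, hp⟩ := Nat.exists_infinite_primes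
    (Group.nilpotencyClass (V.RelFree (ULift.{u} (Fin 4))) + 1)
  exact ⟨⟨_, _, FreeClassTwo.powers.{u} p, hF, (key p hp hle).1.ne'⟩, hF, hnil, key⟩
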